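/- Let $X$ be a (real or complex) Hilbert space, $U$ a normed space over the same field, and let $A$ be the infinitesimal generator of an analytic semigroup $S=(S(t))_{t\ge 0}$ on $X$. Let $Q\subseteq X\times U$ be open with $(0,0)\in Q$, and let $f:Q\to X$ satisfy $f(0,0)=0$ and $$f(x,u)=Bx+Cu+g(x,u),\qquad (x,u)\in Q,$$ where $B\in L(X)$, $C\in L(U,X)$, and for every $w>0$ there is $\rho>0$ such that $\|g(x,u)\|_X\le w(\|x\|_X+\|u\|_U)$ whenever $\|x\|_X\le\rho$ and $\|u\|_U\le\rho$. Let $U_c$ be a (semi)normed linear space of strongly measurable inputs $u:[0,\infty)\to U$ for which there is a constant $c$ with $\|u(s)\|_U\le c\,\|u\|_{U_c}$ for all $u\in U_c$ and almost every $s\ge 0$ (for instance, bounded continuous, bounded piecewise right-continuous, or $L_\infty$ inputs, with the supremum norm). Let $\Sigma=(X,U_c,\phi)$ be a control system of the equation $$\dot x=Ax+f(x,u). \qquad (1)$$ That is, $\phi(t,t_0,x,u)$ (the state at time $t$ when the state at time $t_0$ is $x$ and the input is $u$) satisfies the axioms of local existence, identity, causality, continuity in $t$ and the semigroup property, and its trajectories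 are mild solutions as long as they stay in $Q$: if $(\phi(s,t_0,x,u),u(s))\in Q$ for almost every $s\in[t_0,t]$, then $$\phi(t,t_0,x,u)=S(t-t_0)x+\int_{t_0}^t S(t-s)f(\phi(s,t_0,x,u),u(s))\,ds$$ with a Bochner integral. Let $R=A+B$ with $D(R)=D(A)$, let $T$ be the $C_0$-semigroup generated by $R$, and suppose that the linear approximation $\dot x=Rx+Cu$, that is, the control system $\phi_{\rm lin}(t,t_0,x,u)=T(t-t_0)x+\int_{t_0}^tT(t-s)Cu(s)\,ds$ with inputs from $U_c$, is input-to-state stable: there are $\beta\in\mathcal{KL}$ and $\gamma\in\mathcal K$ with $$\|\phi_{\rm lin}(t,0,x,u)\|_X\le\beta(\|x\|_X,t)+\gamma(\|u\|_{U_c})\qquad\text{for all } x\in X,\ u\in U_c,\ t\ge 0.$$ Suppose further that there is a coercive operator $P\in L(X)$ (that is, $P$ is self-adjoint, $\langle Px,x\rangle>0$ for $x\ne0$, and $\langle Px,x\rangle\ge\epsilon\|x\|_X^2$ for some $\epsilon>0$ and all $x\in X$) such that $$\langle Rx,Px\rangle+\langle Px,Rx\rangle=-\|x\|_X^2\qquad\text{for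 all } x\in D(R).$$ Then $V(x)=\langle Px,x\rangle$, $x\in X$, is a LISS-Lyapunov function for $\Sigma$: $V:X\to[0,\infty)$ is continuous, and there are $\rho_x,\rho_u>0$, $\psi_1,\psi_2\in\mathcal K_\infty$, $\chi\in\mathcal K$ and a (continuous) positive definite function $\alpha$ such that $\psi_1(\|x\|_X)\le V(x)\le\psi_2(\|x\|_X)$ for all $x\in X$ and, for all $x\in X$ with $\|x\|_X\le\rho_x$ and all $u\in U_c$ with $\|u\|_{U_c}\le\rho_u$, $$\|x\|_X\ge\chi(\|u\|_{U_c})\ \Longrightarrow\ \limsup_{t\to+0}\frac1t\bigl(V(\phi(t,0,x,u))-V(x)\bigr)\le-\alpha(\|x\|_X).$$ -/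

import Mathlib

open Set Filter Topology MeasureTheory

noncomputable section

namespace ISS

/-! ### Comparison functions -/

/-- Class `𝒦` on `[0, ∞)`: continuous, strictly increasing, zero at zero. Only the values of `γ` on
`[0, ∞)` are relevant (they are automatically nonnegative). -/
structure ClassK (γ : ℝ → ℝ) : Prop where
  continuousOn : ContinuousOn γ (Ici 0)
  strictMonoOn : StrictMonoOn γ (Ici 0)
  map_zero : γ 0 = 0

/-- Class `𝒦_∞`: unbounded functions of class `𝒦`. -/
structure ClassKInf (γ : ℝ → ℝ) : Prop extends ClassK γ where
  unbounded : ¬ BddAbove (γ '' Ici 0)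

/-- Class `ℒ`: continuous, decreasing, nonnegative, with limit zero at infinity. -/
structure ClassL (γ : ℝ → ℝ) : Prop where
  continuousOn : ContinuousOn γ (Ici 0)
  antitoneOn : AntitoneOn γ (Ici 0)
  nonneg : ∀ t, 0 ≤ t → 0 ≤ γ t
  tendsto : Tendsto γ atTop (𝓝 0)

/-- Class `𝒦ℒ`. -/
structure ClassKL (β : ℝ → ℝ → ℝ) : Prop where
  classK : ∀ t, 0 ≤ t → ClassK (fun r => β r t)
  classL : ∀ r, 0 < r → ClassL (fun t => β r t)

/-- Positive definite functions on `[0, ∞)`. -/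
structure PosDefFun (α : ℝ → ℝ) : Prop where
  continuousOn : ContinuousOn α (Ici 0)
  map_zero : α 0 = 0
  pos : ∀ r, 0 < r → 0 < α r

/-! ### `C₀`-semigroups -/

section Semigroup

variable (𝕜 X : Type*) [RCLike 𝕜] [NormedAddCommGroup X] [NormedSpace 𝕜 X]

/-- A `C₀`-semigroup of bounded linear operators on `X`. Only the operators `T t` with `0 ≤ t`
are relevant. -/
structure C0Semigroup where
  toFun : ℝ → X →L[𝕜] X
  map_zero : toFun 0 = ContinuousLinearMap.id 𝕜 X
  map_add : ∀ s t, 0 ≤ s → 0 ≤ t → toFun (s + t) = (toFun s).comp (toFun t)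
  continuousOn : ∀ x, ContinuousOn (fun t => toFun t x) (Ici 0)

variable {𝕜 X}

instance : CoeFun (C0Semigroup 𝕜 X) (fun _ => ℝ → X →L[𝕜] X) := ⟨C0Semigroup.toFun⟩

/-- `A` is the infinitesimal generator of `T`: `x ∈ D(A)` and `A x = y` if and only if
`(T t x - x) / t → y` as `t → 0+`. -/
def C0Semigroup.IsGeneratedBy [NormedSpace ℝ X] (T : C0Semigroup 𝕜 X) (A : X →ₗ.[𝕜] X) : Prop :=
  ∀ x y : X, (x, y) ∈ A.graph ↔
    Tendsto (fun t : ℝ => t⁻¹ • (T t x - x)) (𝓝[>] 0) (𝓝 y)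

/-- An analytic semigroup: a `C₀`-semigroup all of whose orbits `t ↦ T t x` are real analytic on
`(0, ∞)`. This is the definition of D. Henry's monograph on semilinear parabolic equations. A
semigroup that extends holomorphically to a sector around `(0, ∞)` is analytic in this sense; the
present definition makes sense over `ℝ` and over `ℂ`. -/
def C0Semigroup.IsAnalytic [NormedSpace ℝ X] (T : C0Semigroup 𝕜 X) : Prop :=
  ∀ x : X, AnalyticOnNhd ℝ (fun t : ℝ => T t x) (Ioi 0)

/-- The operator `A + B` with domain `D(A)`, for `B` bounded. -/
def addBounded (A : X →ₗ.[𝕜] X) (B : X →L[𝕜] X) : X →ₗ.[𝕜] X where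
  domain := A.domain
  toFun := A.toFun + (B : X →ₗ[𝕜] X).comp A.domain.subtype

end Semigroup

/-! ### Inputs and control systems -/

/-- A space `U_c` of admissible inputs `u : ℝ₊ → U`: a linear space of strongly measurable
functions with a (semi)norm `‖·‖_{U_c}` that dominates, up to a constant, the essential supremum
norm. Examples are the spaces of bounded continuous, bounded piecewise right-continuous, and
strongly measurable essentially bounded functions with the (essential) supremum norm, where `c = 1`.
Inputs are functions on `ℝ`, but only their restrictions to `[0, ∞)` are used. -/
structure InputSpace (𝕜 U : Type*) [RCLike 𝕜] [NormedAddCommGroup U] [NormedSpace 𝕜 U] where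
  carrier : Submodule 𝕜 (ℝ → U)
  norm : Seminorm 𝕜 carrier
  aestronglyMeasurable : ∀ u : carrier,
    AEStronglyMeasurable (u : ℝ → U) (volume.restrict (Ici 0))
  bounded : ∃ c : ℝ, ∀ u : carrier,
    ∀ᵐ s ∂(volume.restrict (Ici (0 : ℝ))), ‖(u : ℝ → U) s‖ ≤ c * norm u

variable {𝕜 X U : Type*} [RCLike 𝕜] [NormedAddCommGroup X] [NormedAddCommGroup U]
  [NormedSpace 𝕜 U]

/-- A control system `(X, U_c, φ)`; `φ t t₀ x u` is the state at time `t` if the state at time `t₀`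
was `x` and the input `u` was applied. It is meaningful on the set `domain` of quadruples
`(t, t₀, x, u)`. -/
structure ControlSystem (Uc : InputSpace 𝕜 U) (X : Type*) [NormedAddCommGroup X] where
  domain : Set (ℝ × ℝ × X × Uc.carrier)
  φ : ℝ → ℝ → X → Uc.carrier → X
  nonneg : ∀ t t₀ x u, (t, t₀, x, u) ∈ domain → 0 ≤ t ∧ 0 ≤ t₀
  existence : ∀ t₀ x u, 0 ≤ t₀ → ∃ t, t₀ < t ∧ ∀ s ∈ Icc t₀ t, (s, t₀, x, u) ∈ domain
  identity : ∀ t₀ x u, 0 ≤ t₀ → φ t₀ t₀ x u = x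
  causality : ∀ t t₀ x u, (t, t₀, x, u) ∈ domain →
    ∀ v : Uc.carrier, (∀ s ∈ Icc t₀ t, (u : ℝ → U) s = (v : ℝ → U) s) →
      (t, t₀, x, v) ∈ domain ∧ φ t t₀ x v = φ t t₀ x u
  continuity : ∀ t₀ x u, 0 ≤ t₀ →
    ContinuousOn (fun t => φ t t₀ x u) {t | t₀ ≤ t ∧ (t, t₀, x, u) ∈ domain}
  semigroup : ∀ t s x u, 0 ≤ s → s ≤ t → (t, s, x, u) ∈ domain → ∀ r ∈ Icc s t,
    (r, s, x, u) ∈ domain ∧ (t, r, φ r s x u, u) ∈ domain ∧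
      φ t r (φ r s x u) u = φ t s x u

namespace ControlSystem

variable {Uc : InputSpace 𝕜 U}

/-- Input-to-state stability. -/
def IsISS (sys : ControlSystem Uc X) : Prop :=
  ∃ β : ℝ → ℝ → ℝ, ∃ γ : ℝ → ℝ, ClassKL β ∧ ClassK γ ∧
    ∀ (x : X) (u : Uc.carrier) (t : ℝ), 0 ≤ t →
      (t, 0, x, u) ∈ sys.domain ∧ ‖sys.φ t 0 x u‖ ≤ β ‖x‖ t + γ (Uc.norm u)

/-- The Lie derivative of `V` at `x` corresponding to the input `u`: the upper right derivative of
`V` along the trajectory at time zero, with values in `[-∞, ∞]`. -/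
def lieDeriv (sys : ControlSystem Uc X) (V : X → ℝ) (x : X) (u : Uc.carrier) : EReal :=
  limsup (fun t : ℝ => ((t⁻¹ * (V (sys.φ t 0 x u) - V x) : ℝ) : EReal)) (𝓝[>] 0)

/-- `V : D → ℝ₊` is a local ISS-Lyapunov function. The requirement `closedBall 0 ρx ⊆ interior D`
makes sure that `V` is defined at the points where its Lie derivative is taken, and near them. -/
def IsLISSLyapunovFunction (sys : ControlSystem Uc X) (D : Set X) (V : X → ℝ) : Prop :=
  (0 : X) ∈ interior D ∧ ContinuousOn V D ∧ (∀ x ∈ D, 0 ≤ V x) ∧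
  ∃ ρx ρu : ℝ, 0 < ρx ∧ 0 < ρu ∧ Metric.closedBall 0 ρx ⊆ interior D ∧
  ∃ ψ₁ ψ₂ χ α : ℝ → ℝ, ClassKInf ψ₁ ∧ ClassKInf ψ₂ ∧ ClassK χ ∧ PosDefFun α ∧
    (∀ x ∈ D, ψ₁ ‖x‖ ≤ V x ∧ V x ≤ ψ₂ ‖x‖) ∧
    ∀ x : X, ‖x‖ ≤ ρx → ∀ u : Uc.carrier, Uc.norm u ≤ ρu →
      χ (Uc.norm u) ≤ ‖x‖ → sys.lieDeriv V x u ≤ ((-α ‖x‖ : ℝ) : EReal)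

/-- `sys` is the control system of the equation `ẋ = A x + f(x, u)`, where `A` generates `S` and `f`
is defined on `Q`: as long as `(x, u)` stays in `Q`, the trajectories of `sys` are mild solutions,
that is, solutions of the integral equation given by the variation of constants formula
(with a Bochner integral). The values of `f` outside `Q` are irrelevant. -/
def IsMildFlow [NormedSpace 𝕜 X] [NormedSpace ℝ X] (sys : ControlSystem Uc X)
    (S : C0Semigroup 𝕜 X) (Q : Set (X × U)) (f : X → U → X) : Prop :=
  ∀ t t₀ x u, (t, t₀, x, u) ∈ sys.domain → t₀ ≤ t →
    (∀ᵐ s ∂(volume.restrict (Icc t₀ t)), (sys.φ s t₀ x u, (u : ℝ → U) s) ∈ Q) →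
    IntervalIntegrable (fun s => S (t - s) (f (sys.φ s t₀ x u) ((u : ℝ → U) s))) volume t₀ t ∧
    sys.φ t t₀ x u =
      S (t - t₀) x + ∫ s in t₀..t, S (t - s) (f (sys.φ s t₀ x u) ((u : ℝ → U) s))

end ControlSystem

/-! ### The linear control system `ẋ = R x + C u` -/

section Linear

variable [NormedSpace 𝕜 X]

theorem C0Semigroup.exists_bound [CompleteSpace X] (T : C0Semigroup 𝕜 X) (a : ℝ) :
    ∃ M : ℝ, 0 ≤ M ∧ ∀ t ∈ Icc 0 a, ‖T t‖ ≤ M := by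
  have h : ∀ x : X, ∃ K, ∀ t : Icc (0 : ℝ) a, ‖T (t : ℝ) x‖ ≤ K := by
    intro x
    have hc : ContinuousOn (fun t => T t x) (Icc 0 a) :=
      (T.continuousOn x).mono fun t ht => ht.1
    obtain ⟨K, hK⟩ := isCompact_Icc.exists_bound_of_continuousOn hc
    exact ⟨K, fun t => hK t t.2⟩
  obtain ⟨M, hM⟩ := banach_steinhaus h
  exact ⟨max M 0, le_max_right _ _, fun t ht => (hM ⟨t, ht⟩).trans (le_max_left _ _)⟩

/-- Joint continuity of `(t, y) ↦ T t y`, with the time clipped to `[0, ∞)`. -/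
theorem C0Semigroup.continuous_uncurry [CompleteSpace X] (T : C0Semigroup 𝕜 X) :
    Continuous (fun p : ℝ × X => T (max p.1 0) p.2) := by
  rw [continuous_iff_continuousAt]
  rintro ⟨t, y⟩
  obtain ⟨M, hM0, hM⟩ := T.exists_bound (|t| + 1)
  have h1 : Continuous (fun s : ℝ => T (max s 0) y) :=
    (T.continuousOn y).comp_continuous (continuous_id.max continuous_const)
      (fun s => mem_Ici.2 (le_max_right _ _))
  have h2 : Tendsto (fun p : ℝ × X => M * ‖p.2 - y‖ + ‖T (max p.1 0) y - T (max t 0) y‖)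
      (𝓝 (t, y)) (𝓝 0) := by
    have : Continuous (fun p : ℝ × X => M * ‖p.2 - y‖ + ‖T (max p.1 0) y - T (max t 0) y‖) := by
      have := h1.comp (continuous_fst (X := ℝ) (Y := X))
      simp only [Function.comp_def] at this
      fun_prop
    simpa using this.tendsto (t, y)
  rw [ContinuousAt, tendsto_iff_norm_sub_tendsto_zero]
  refine squeeze_zero' (Eventually.of_forall fun _ => norm_nonneg _) ?_ h2
  have hn : ∀ᶠ p : ℝ × X in 𝓝 (t, y), p.1 < |t| + 1 := by
    refine (continuous_fst.tendsto (t, y)).eventually (gt_mem_nhds ?_)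
    exact lt_of_le_of_lt (le_abs_self t) (lt_add_one _)
  filter_upwards [hn] with p hp
  have e : T (max p.1 0) p.2 - T (max t 0) y
      = T (max p.1 0) (p.2 - y) + (T (max p.1 0) y - T (max t 0) y) := by
    rw [map_sub]; abel
  rw [e]
  refine (norm_add_le _ _).trans (add_le_add ?_ le_rfl)
  refine ((T (max p.1 0)).le_opNorm _).trans ?_
  refine mul_le_mul_of_nonneg_right (hM _ ⟨le_max_right _ _, ?_⟩) (norm_nonneg _)
  exact max_le hp.le (by positivity)

variable {Uc : InputSpace 𝕜 U}

theorem measurable_clipped [CompleteSpace X] (T : C0Semigroup 𝕜 X) (C : U →L[𝕜] X)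
    (u : Uc.carrier) (t : ℝ) :
    AEStronglyMeasurable (fun s => T (max (t - s) 0) (C ((u : ℝ → U) s)))
      (volume.restrict (Ici 0)) := by
  have h := Uc.aestronglyMeasurable u
  have h' : AEStronglyMeasurable (fun s : ℝ => (t - s, C ((u : ℝ → U) s)))
      (volume.restrict (Ici 0)) :=
    (continuous_const.sub continuous_id).aestronglyMeasurable.prodMk
      (C.continuous.comp_aestronglyMeasurable h)
  exact T.continuous_uncurry.comp_aestronglyMeasurable h'

theorem bound_clipped [CompleteSpace X] (T : C0Semigroup 𝕜 X) (C : U →L[𝕜] X)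
    (u : Uc.carrier) (a : ℝ) :
    ∃ K : ℝ, 0 ≤ K ∧ ∀ t ≤ a,
      ∀ᵐ s ∂(volume.restrict (Ici (0 : ℝ))), ‖T (max (t - s) 0) (C ((u : ℝ → U) s))‖ ≤ K := by
  obtain ⟨c, hc⟩ := Uc.bounded
  obtain ⟨M, hM0, hM⟩ := T.exists_bound (max a 0)
  refine ⟨M * (‖C‖ * (|c| * Uc.norm u)), by positivity, fun t ht => ?_⟩
  filter_upwards [hc u, ae_restrict_mem measurableSet_Ici] with s hs hs0
  have hs0 : (0 : ℝ) ≤ s := hs0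
  refine ((T _).le_opNorm _).trans (mul_le_mul (hM _ ⟨le_max_right _ _, ?_⟩) ?_
    (norm_nonneg _) hM0)
  · exact max_le_max (by linarith) le_rfl
  · refine (C.le_opNorm _).trans (mul_le_mul_of_nonneg_left (hs.trans ?_) (norm_nonneg _))
    exact mul_le_mul_of_nonneg_right (le_abs_self c) (apply_nonneg _ _)

theorem integrable_clipped [CompleteSpace X] (T : C0Semigroup 𝕜 X) (C : U →L[𝕜] X)
    (u : Uc.carrier) (t : ℝ) {a b : ℝ} (ha : 0 ≤ a) (hb : 0 ≤ b) :
    IntervalIntegrable (fun s => T (max (t - s) 0) (C ((u : ℝ → U) s))) volume a b := by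
  obtain ⟨K, hK0, hK⟩ := bound_clipped T C u t
  have hsub : Set.uIoc a b ⊆ Ici 0 := fun s hs => (le_min ha hb).trans hs.1.le
  rw [intervalIntegrable_iff]
  rw [Set.uIoc] at hsub ⊢
  refine Integrable.mono' (g := fun _ => K) (integrable_const K) ?_ ?_
  · exact (measurable_clipped T C u t).mono_set hsub
  · exact ae_restrict_of_ae_restrict_of_subset hsub (hK t le_rfl)

theorem integral_clipped [NormedSpace ℝ X] (T : C0Semigroup 𝕜 X) (C : U →L[𝕜] X)
    (u : Uc.carrier) {t₀ t : ℝ} (h : t₀ ≤ t) :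
    ∫ s in t₀..t, T (t - s) (C ((u : ℝ → U) s))
      = ∫ s in t₀..t, T (max (t - s) 0) (C ((u : ℝ → U) s)) := by
  refine intervalIntegral.integral_congr fun s hs => ?_
  rw [uIcc_of_le h] at hs
  rw [max_eq_left (by linarith [hs.2])]

theorem continuousOn_convolution [CompleteSpace X] [NormedSpace ℝ X] (T : C0Semigroup 𝕜 X)
    (C : U →L[𝕜] X) (u : Uc.carrier) {t₀ : ℝ} (h0 : 0 ≤ t₀) :
    ContinuousOn (fun t => ∫ s in t₀..t, T (t - s) (C ((u : ℝ → U) s))) (Ici t₀) := by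
  have key : ContinuousOn
      (fun t => ∫ s in t₀..t, T (max (t - s) 0) (C ((u : ℝ → U) s))) (Ici t₀) := by
    intro t ht
    have ht : t₀ ≤ t := ht
    obtain ⟨K, hK0, hK⟩ := bound_clipped T C u (t + 1)
    -- on a neighbourhood of `t`, integrate an indicator over a fixed interval
    have hev : ∀ᶠ r in 𝓝[Ici t₀] t, r ≤ t + 1 ∧ t₀ ≤ r := by
      refine Filter.Eventually.and ?_ self_mem_nhdsWithin
      exact mem_nhdsWithin_of_mem_nhds (Iic_mem_nhds (by linarith))
    have hsub : Ioc t₀ (t + 1) ⊆ Ici 0 := fun s hs => h0.trans hs.1.le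
    have e : ∀ r, r ≤ t + 1 → t₀ ≤ r →
        ∫ s in t₀..r, T (max (r - s) 0) (C ((u : ℝ → U) s))
          = ∫ s in Ioc t₀ (t + 1),
            (Iic r).indicator (fun s => T (max (r - s) 0) (C ((u : ℝ → U) s))) s := by
      intro r hr hr0
      rw [intervalIntegral.integral_of_le hr0, setIntegral_indicator measurableSet_Iic]
      congr 2
      ext s
      simp only [mem_Ioc, mem_inter_iff, mem_Iic]
      constructor
      · rintro ⟨a, b⟩; exact ⟨⟨a, b.trans hr⟩, b⟩
      · rintro ⟨⟨a, _⟩, b⟩; exact ⟨a, b⟩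
    have hlim : ContinuousWithinAt (fun r => ∫ s in Ioc t₀ (t + 1),
        (Iic r).indicator (fun s => T (max (r - s) 0) (C ((u : ℝ → U) s))) s) (Ici t₀) t := by
      refine continuousWithinAt_of_dominated (bound := fun _ => K) ?_ ?_ ?_ ?_
      · refine Eventually.of_forall fun r => ?_
        exact ((measurable_clipped T C u r).mono_measure
          (Measure.restrict_mono hsub le_rfl)).indicator measurableSet_Iic
      · filter_upwards [hev] with r hr
        filter_upwards [ae_restrict_of_ae_restrict_of_subset hsub (hK r hr.1)] with s hs
        exact (norm_indicator_le_norm_self _ _).trans hs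
      · exact integrable_const K
      · have : ∀ᵐ s ∂(volume.restrict (Ioc t₀ (t + 1))), s ≠ t :=
          ae_restrict_of_ae (by simp [ae_iff])
        filter_upwards [this] with s hs
        refine ContinuousAt.continuousWithinAt ?_
        rcases lt_or_gt_of_ne hs with h | h
        · have hc : Continuous (fun r : ℝ => T (max (r - s) 0) (C ((u : ℝ → U) s))) :=
            T.continuous_uncurry.comp
              ((continuous_id.sub continuous_const).prodMk continuous_const)
          refine hc.continuousAt.congr ?_
          filter_upwards [lt_mem_nhds h] with r hr
          rw [indicator_of_mem (by exact hr.le)]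
        · refine (continuousAt_const (y := (0 : X))).congr ?_
          filter_upwards [gt_mem_nhds h] with r hr
          rw [indicator_of_notMem (by simpa using hr)]
    refine hlim.congr_of_eventuallyEq ?_ (e t (by linarith) ht)
    filter_upwards [hev] with r hr using e r hr.1 hr.2
  exact key.congr fun t ht => integral_clipped T C u ht

/-- The control system of the linear equation `ẋ = R x + C u`, where `R` generates `T`, given by
`φ(t, t₀, x, u) = T(t - t₀) x + ∫_{t₀}^t T(t - s) C u(s) ds`. -/
def linearControlSystem [CompleteSpace X] [NormedSpace ℝ X] [IsScalarTower ℝ 𝕜 X]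
    (Uc : InputSpace 𝕜 U) (T : C0Semigroup 𝕜 X) (C : U →L[𝕜] X) : ControlSystem Uc X where
  domain := {p | 0 ≤ p.2.1 ∧ p.2.1 ≤ p.1}
  φ t t₀ x u := T (t - t₀) x + ∫ s in t₀..t, T (t - s) (C ((u : ℝ → U) s))
  nonneg t t₀ x u h := ⟨h.1.trans h.2, h.1⟩
  existence t₀ x u h := ⟨t₀ + 1, by linarith, fun s hs => ⟨h, hs.1⟩⟩
  identity t₀ x u h := by simp [T.map_zero]
  causality t t₀ x u h v huv := by
    refine ⟨h, ?_⟩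
    congr 1
    refine intervalIntegral.integral_congr fun s hs => ?_
    rw [uIcc_of_le h.2] at hs
    rw [huv s hs]
  continuity t₀ x u h := by
    refine ContinuousOn.mono (s := Ici t₀) ?_ fun t ht => ht.1
    refine ContinuousOn.add ?_ (continuousOn_convolution T C u h)
    exact (T.continuousOn x).comp (continuousOn_id.sub continuousOn_const)
      fun t ht => mem_Ici.2 (sub_nonneg.2 ht)
  semigroup t s x u hs hst _ r hr := by
    refine ⟨⟨hs, hr.1⟩, ⟨hs.trans hr.1, hr.2⟩, ?_⟩
    have hr0 : 0 ≤ r := hs.trans hr.1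
    have ht0 : 0 ≤ t := hs.trans hst
    have e1 : T (t - r) (T (r - s) x) = T (t - s) x := by
      have := T.map_add (t - r) (r - s) (sub_nonneg.2 hr.2) (sub_nonneg.2 hr.1)
      rw [sub_add_sub_cancel] at this
      rw [this]; rfl
    have e2 : T (t - r) (∫ y in s..r, T (r - y) (C ((u : ℝ → U) y)))
        = ∫ y in s..r, T (max (t - y) 0) (C ((u : ℝ → U) y)) := by
      rw [integral_clipped T C u hr.1]
      have := ContinuousLinearMap.intervalIntegral_comp_comm (𝕜 := 𝕜) (T (t - r))
        (integrable_clipped T C u r hs hr0)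
      rw [← this]
      refine intervalIntegral.integral_congr fun y hy => ?_
      rw [uIcc_of_le hr.1] at hy
      have := T.map_add (t - r) (r - y) (sub_nonneg.2 hr.2) (sub_nonneg.2 hy.2)
      rw [sub_add_sub_cancel] at this
      rw [max_eq_left (sub_nonneg.2 hy.2), max_eq_left (by linarith [hy.2, hr.2]), this]
      rfl
    have e3 := intervalIntegral.integral_add_adjacent_intervals
      (integrable_clipped T C u t hs hr0) (integrable_clipped T C u t hr0 ht0)
    rw [map_add, e1, e2, integral_clipped T C u hr.2, integral_clipped T C u hst, ← e3, add_assoc]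

end Linear

/-! ### Coercive operators -/

/-- A coercive operator: bounded, self-adjoint, positive, and bounded below in the sense of
quadratic forms. -/
structure IsCoerciveOperator {𝕜 X : Type*} [RCLike 𝕜] [NormedAddCommGroup X]
    [InnerProductSpace 𝕜 X] [CompleteSpace X] (P : X →L[𝕜] X) : Prop where
  isSelfAdjoint : IsSelfAdjoint P
  pos : ∀ x : X, x ≠ 0 → 0 < RCLike.re (inner 𝕜 (P x) x)
  coercive : ∃ ε : ℝ, 0 < ε ∧ ∀ x : X, ε * ‖x‖ ^ 2 ≤ RCLike.re (inner 𝕜 (P x) x)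

end ISS

end

namespace ISS

/-! ### Real parts of the sesquilinear form of a self-adjoint operator. -/

section QuadraticForm

variable {𝕜 X : Type*} [RCLike 𝕜] [NormedAddCommGroup X] [InnerProductSpace 𝕜 X]

/-! The difficulty is that the Lyapunov equation holds only on `D(A)`, while the Lie derivative is
needed at every state `x`. Analyticity removes it: `S(t)x` lies in `D(A)` for `t > 0`, so `V(S(t)x)`
is differentiable there, and the Lyapunov equation for `R = A + B` expresses its derivative through
bounded operators only, as `-‖z‖² - 2 Re⟪Pz, Bz⟫` with `z = S(t)x`. This is continuous down to `t =
0`, so the right derivative at zero exists for all `x` (`hasDerivWithinAt_quadForm_orbit`).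

The mild solution is compared with the orbit of `S` itself: `φ(t) = S(t)x + tBx + O(Kt)`, where `K`
collects the input, the remainder `g` and an arbitrarily small `δ` (`IsMildFlow.norm_sub_le`). In
the expansion of `V(φ(t))` the term `2t Re⟪PBx, x⟫` cancels the `B`-term of the orbit derivative,
leaving `-‖x‖² + 2‖P‖K‖x‖` as a bound for the Lie derivative (`lieDeriv_quadForm_le`). For small `x`
and `u`, with `‖x‖` above a linear gain in the input norm, the error is at most `‖x‖²/2`. Coercivity
and boundedness of `P` give the quadratic bounds on `V`. -/

theorem abs_re_inner_apply_le (P : X →L[𝕜] X) (a b : X) :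
    |RCLike.re (inner 𝕜 (P a) b)| ≤ ‖P‖ * ‖a‖ * ‖b‖ :=
  (RCLike.abs_re_le_norm _).trans <| (norm_inner_le_norm _ _).trans <|
    mul_le_mul_of_nonneg_right (P.le_opNorm a) (norm_nonneg b)

theorem re_inner_apply_comm [CompleteSpace X] {P : X →L[𝕜] X} (hP : IsSelfAdjoint P) (a b : X) :
    RCLike.re (inner 𝕜 (P a) b) = RCLike.re (inner 𝕜 (P b) a) := by
  rw [← inner_re_symm a (P b)]
  exact congrArg RCLike.re (hP.isSymmetric a b)

theorem re_inner_apply_add_self [CompleteSpace X] {P : X →L[𝕜] X} (hP : IsSelfAdjoint P)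
    (a b : X) :
    RCLike.re (inner 𝕜 (P (a + b)) (a + b)) = RCLike.re (inner 𝕜 (P a) a)
      + 2 * RCLike.re (inner 𝕜 (P b) a) + RCLike.re (inner 𝕜 (P b) b) := by
  simp only [map_add, inner_add_left, inner_add_right]
  rw [re_inner_apply_comm hP a b]
  ring

end QuadraticForm

/-! ### Smoothing by the analytic semigroup. -/

section Semigroup

variable {𝕜 X : Type*} [RCLike 𝕜] [NormedAddCommGroup X] [NormedSpace 𝕜 X] [NormedSpace ℝ X]

/-- An analytic semigroup maps into the domain of its generator at positive times, and its orbits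
solve the Cauchy problem there. -/
theorem C0Semigroup.IsAnalytic.exists_hasDerivAt {S : C0Semigroup 𝕜 X} (hS : S.IsAnalytic)
    {A : X →ₗ.[𝕜] X} (hA : S.IsGeneratedBy A) (x : X) {t : ℝ} (ht : 0 < t) :
    ∃ y, (S t x, y) ∈ A.graph ∧ HasDerivAt (fun s => S s x) y t := by
  have hd : HasDerivAt (fun s => S s x) (deriv (fun s => S s x) t) t :=
    ((hS x t ht).differentiableAt).hasDerivAt
  refine ⟨_, (hA _ _).2 ?_, hd⟩
  refine hd.tendsto_slope_zero_right.congr' ?_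
  filter_upwards [self_mem_nhdsWithin] with h hh
  -- The semigroup law turns the slope of the orbit at `t` into the generator's difference quotient
  -- at the point `S t x`.
  rw [add_comm t h, S.map_add h t (le_of_lt hh) ht.le]
  rfl

end Semigroup

/-! ### The quadratic form along orbits of `S`. -/

section Lyapunov

variable {𝕜 X : Type*} [RCLike 𝕜] [NormedAddCommGroup X] [InnerProductSpace 𝕜 X]

/-- Since `R x = y + B x`, the bounded part of the Lyapunov equation can be moved to the right; the
unbounded `y` then disappears from the derivative of `V` along an orbit. -/
theorem two_mul_re_inner_of_mem_graph {A : X →ₗ.[𝕜] X} {B P : X →L[𝕜] X}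
    (hLyap : ∀ x : (addBounded A B).domain,
      inner 𝕜 (addBounded A B x) (P x) + inner 𝕜 (P x) (addBounded A B x)
        = -((‖(x : X)‖ : 𝕜) ^ 2)) {x y : X} (h : (x, y) ∈ A.graph) :
    2 * RCLike.re (inner 𝕜 (P x) y) = -‖x‖ ^ 2 - 2 * RCLike.re (inner 𝕜 (P x) (B x)) := by
  obtain ⟨z, rfl, rfl⟩ := (LinearPMap.mem_graph_iff A).1 h
  have e : addBounded A B z = A z + B z := rfl
  have h1 := congrArg RCLike.re (hLyap z)
  rw [e, map_add, inner_re_symm (A z + B z), inner_add_right, map_add, map_neg,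
    ← RCLike.ofReal_pow, RCLike.ofReal_re] at h1
  linarith

variable [CompleteSpace X] [NormedSpace ℝ X]

/-- Right derivative at zero of `t ↦ ⟪P S(t) x, S(t) x⟫` for an arbitrary initial state `x`. -/
theorem hasDerivWithinAt_quadForm_orbit {S : C0Semigroup 𝕜 X} (hS : S.IsAnalytic)
    {A : X →ₗ.[𝕜] X} (hA : S.IsGeneratedBy A) {B P : X →L[𝕜] X} (hP : IsSelfAdjoint P)
    (hLyap : ∀ x : (addBounded A B).domain,
      inner 𝕜 (addBounded A B x) (P x) + inner 𝕜 (P x) (addBounded A B x)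
        = -((‖(x : X)‖ : 𝕜) ^ 2)) (x : X) :
    HasDerivWithinAt (fun t => RCLike.re (inner 𝕜 (P (S t x)) (S t x)))
      (-‖x‖ ^ 2 - 2 * RCLike.re (inner 𝕜 (P x) (B x))) (Ici 0) 0 := by
  have hc : ContinuousWithinAt (fun t => S t x) (Ioi 0) 0 :=
    (S.continuousOn x 0 self_mem_Ici).mono Ioi_subset_Ici_self
  have hd : ∀ t : ℝ, 0 < t → HasDerivAt (fun t => RCLike.re (inner 𝕜 (P (S t x)) (S t x)))
      (-‖S t x‖ ^ 2 - 2 * RCLike.re (inner 𝕜 (P (S t x)) (B (S t x)))) t := by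
    intro t ht
    obtain ⟨y, hy, hd⟩ := hS.exists_hasDerivAt hA x ht
    have hPd : HasDerivAt (fun s => P (S s x)) (P y) t :=
      (P.restrictScalars ℝ).hasFDerivAt.comp_hasDerivAt t hd
    have h := RCLike.reCLM.hasFDerivAt.comp_hasDerivAt t (hPd.inner 𝕜 hd)
    refine h.congr_deriv ?_
    rw [← two_mul_re_inner_of_mem_graph hLyap hy]
    simp only [RCLike.reCLM_apply, map_add]
    rw [re_inner_apply_comm hP y]
    ring
  have hcV : ∀ L : X →L[𝕜] X, Continuous fun z : X => RCLike.re (inner 𝕜 (P z) (L z)) :=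
    fun L => RCLike.continuous_re.comp (P.continuous.inner L.continuous)
  have hx : S 0 x = x := by rw [S.map_zero]; rfl
  -- Continuity at zero and a limit of the derivative from the right yield the one-sided derivative,
  -- even if `x` is outside `D(A)`.
  refine hasDerivWithinAt_Ici_of_tendsto_deriv (s := Ioi 0)
    (fun t ht => (hd t ht).differentiableAt.differentiableWithinAt)
    ((hcV (ContinuousLinearMap.id 𝕜 X)).continuousAt.comp_continuousWithinAt hc)
    self_mem_nhdsWithin ?_
  have hlim : ContinuousWithinAt
      (fun t => -‖S t x‖ ^ 2 - 2 * RCLike.re (inner 𝕜 (P (S t x)) (B (S t x)))) (Ioi 0) 0 :=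
    ((hc.norm.pow 2).neg).sub
      (continuousWithinAt_const.mul ((hcV B).continuousAt.comp_continuousWithinAt hc))
  rw [ContinuousWithinAt, hx] at hlim
  refine hlim.congr' ?_
  filter_upwards [self_mem_nhdsWithin] with t ht using (hd t ht).deriv.symm

end Lyapunov

/-! ### Short-time expansion of mild solutions. -/

section MildFlow

variable {𝕜 X U : Type*} [RCLike 𝕜] [NormedAddCommGroup X] [NormedSpace 𝕜 X] [NormedSpace ℝ X]
  [CompleteSpace X] [NormedAddCommGroup U] [NormedSpace 𝕜 U] {Uc : InputSpace 𝕜 U}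

/-- First-order expansion of a mild solution at time zero: up to the contribution of the input and
of the nonlinear remainder, `φ(t) ≈ S(t) x + t B x`. -/
theorem ControlSystem.IsMildFlow.norm_sub_le {sys : ControlSystem Uc X} {S : C0Semigroup 𝕜 X}
    {Q : Set (X × U)} {f : X → U → X} (hsys : sys.IsMildFlow S Q f)
    {B : X →L[𝕜] X} {C : U →L[𝕜] X} {ρ w M v : ℝ} (hw : 0 ≤ w)
    (hM : ∀ t ∈ Icc (0 : ℝ) 1, ‖S t‖ ≤ M)
    (hf : ∀ y r, ‖y‖ ≤ ρ → ‖r‖ ≤ ρ → (y, r) ∈ Q ∧ ‖f y r - (B y + C r)‖ ≤ w * (‖y‖ + ‖r‖))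
    {x : X} (hx : ‖x‖ < ρ) (u : Uc.carrier)
    (hu : ∀ᵐ s ∂(volume.restrict (Ici (0 : ℝ))), ‖(u : ℝ → U) s‖ ≤ v) (hv : v ≤ ρ)
    {δ : ℝ} (hδ : 0 < δ) :
    ∀ᶠ t in 𝓝[>] (0 : ℝ), ‖sys.φ t 0 x u - S t x - t • B x‖
      ≤ t * (δ + M * ((‖C‖ + w) * v + w * (‖x‖ + δ))) := by
  have hM0 : 0 ≤ M := (norm_nonneg _).trans (hM 0 ⟨le_rfl, zero_le_one⟩)
  obtain ⟨t₁, ht₁, hdom⟩ := sys.existence 0 x u le_rfl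
  have hφ : ContinuousWithinAt (fun t => sys.φ t 0 x u) (Icc 0 t₁) 0 :=
    (sys.continuity 0 x u le_rfl 0 ⟨le_rfl, hdom 0 ⟨le_rfl, ht₁.le⟩⟩).mono
      fun s hs => ⟨hs.1, hdom s hs⟩
  have hG : Continuous fun p : ℝ × X => S (max p.1 0) (B p.2) :=
    S.continuous_uncurry.comp (continuous_fst.prodMk (B.continuous.comp continuous_snd))
  obtain ⟨η, hη, hGη⟩ := Metric.continuousAt_iff.1 (hG.continuousAt (x := ((0 : ℝ), x))) δ hδ
  -- Three demands on the distance from `φ(s)` to `x`: `η` for continuity of `S(r)By`, `δ` for the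
  -- size of `φ(s)`, and `ρ - ‖x‖` to stay where `hf` applies.
  have hζ : 0 < min η (min δ (ρ - ‖x‖)) := lt_min hη (lt_min hδ (sub_pos.2 hx))
  obtain ⟨t₂, ht₂, hφt⟩ := Metric.continuousWithinAt_iff.1 hφ _ hζ
  rw [sys.identity 0 x u le_rfl] at hφt
  have hpos : 0 < min (min t₁ t₂) (min η 1) := by positivity
  filter_upwards [Ioo_mem_nhdsGT hpos] with t ht
  obtain ⟨ht0, ht⟩ := ht
  simp only [lt_min_iff] at ht
  obtain ⟨⟨h1, h2⟩, h3, h4⟩ := ht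
  have hnear : ∀ s ∈ Icc 0 t, ‖sys.φ s 0 x u - x‖ < min η (min δ (ρ - ‖x‖)) := by
    intro s hs
    have := hφt ⟨hs.1, hs.2.trans h1.le⟩
      (by rw [Real.dist_eq, sub_zero, abs_of_nonneg hs.1]; exact hs.2.trans_lt h2)
    rwa [dist_eq_norm] at this
  have htri : ∀ s ∈ Icc 0 t, ‖sys.φ s 0 x u‖ ≤ ‖x‖ + δ ∧ ‖sys.φ s 0 x u‖ ≤ ρ := by
    intro s hs
    have h := hnear s hs
    simp only [lt_min_iff] at h
    have h' := norm_le_norm_add_norm_sub' (sys.φ s 0 x u) x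
    constructor <;> linarith [h.2.1, h.2.2]
  have hut : ∀ᵐ s ∂(volume.restrict (Icc 0 t)), ‖(u : ℝ → U) s‖ ≤ v :=
    ae_restrict_of_ae_restrict_of_subset (fun s hs => hs.1) hu
  obtain ⟨hint, heq⟩ := hsys t 0 x u (hdom t ⟨ht0.le, h1.le⟩) ht0.le (by
    filter_upwards [hut, ae_restrict_mem measurableSet_Icc] with s hs hs'
    exact (hf _ _ (htri s hs').2 (hs.trans hv)).1)
  -- Written as an integral, `tBx` joins the variation of constants integral, so a bound on the
  -- integrand suffices; it is needed only almost everywhere, as the input bound is.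
  have hconst : t • B x = (∫ _ in (0 : ℝ)..t, B x : X) := by
    rw [intervalIntegral.integral_const, sub_zero]
  rw [sub_zero] at heq
  rw [heq, add_sub_cancel_left, hconst,
    ← intervalIntegral.integral_sub hint (intervalIntegrable_const (c := B x)), mul_comm t]
  suffices h : ∀ᵐ s : ℝ, s ∈ uIoc 0 t →
      ‖S (t - s) (f (sys.φ s 0 x u) ((u : ℝ → U) s)) - B x‖
        ≤ δ + M * ((‖C‖ + w) * v + w * (‖x‖ + δ)) by
    simpa only [sub_zero, abs_of_pos ht0] using
      intervalIntegral.norm_integral_le_of_norm_le_const_ae h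
  rw [uIoc_of_le ht0.le]
  filter_upwards [(ae_restrict_iff' measurableSet_Icc).1 hut] with s hs hs'
  have hs1 : s ∈ Icc 0 t := ⟨hs'.1.le, hs'.2⟩
  specialize hs hs1
  have hr0 : 0 ≤ t - s := sub_nonneg.2 hs'.2
  have hB : ‖S (t - s) (B (sys.φ s 0 x u)) - B x‖ ≤ δ := by
    have h := @hGη (t - s, sys.φ s 0 x u) (by
      rw [Prod.dist_eq]
      refine max_lt ?_ ?_
      · rw [Real.dist_eq, sub_zero, abs_of_nonneg hr0]
        linarith [hs'.1]
      · rw [dist_eq_norm]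
        exact (hnear s hs1).trans_le (min_le_left _ _))
    simp only [max_eq_left hr0, max_self, S.map_zero, dist_eq_norm] at h
    exact h.le
  have hC : ‖C ((u : ℝ → U) s)‖ ≤ ‖C‖ * v :=
    (C.le_opNorm _).trans (mul_le_mul_of_nonneg_left hs (norm_nonneg _))
  have hg := (hf _ _ (htri s hs1).2 (hs.trans hv)).2
  have hg' : w * (‖sys.φ s 0 x u‖ + ‖(u : ℝ → U) s‖) ≤ w * ((‖x‖ + δ) + v) :=
    mul_le_mul_of_nonneg_left (add_le_add (htri s hs1).1 hs) hw
  have hrest : ‖S (t - s) (f (sys.φ s 0 x u) ((u : ℝ → U) s) - B (sys.φ s 0 x u))‖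
      ≤ M * ((‖C‖ + w) * v + w * (‖x‖ + δ)) := by
    refine ((S (t - s)).le_opNorm _).trans (mul_le_mul (hM _ ⟨hr0, by linarith [hs'.1]⟩) ?_
      (norm_nonneg _) hM0)
    have e : f (sys.φ s 0 x u) ((u : ℝ → U) s) - B (sys.φ s 0 x u)
        = (f (sys.φ s 0 x u) ((u : ℝ → U) s) - (B (sys.φ s 0 x u) + C ((u : ℝ → U) s)))
          + C ((u : ℝ → U) s) := by abel
    rw [e]
    refine (norm_add_le _ _).trans ?_
    linarith
  have e : S (t - s) (f (sys.φ s 0 x u) ((u : ℝ → U) s)) - B x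
      = (S (t - s) (B (sys.φ s 0 x u)) - B x)
        + S (t - s) (f (sys.φ s 0 x u) ((u : ℝ → U) s) - B (sys.φ s 0 x u)) := by
    rw [map_sub]; abel
  rw [e]
  exact (norm_add_le _ _).trans (add_le_add hB hrest)

end MildFlow

/-! ### The Lie derivative of the quadratic form. -/

section LieDerivative

variable {𝕜 X U : Type*} [RCLike 𝕜] [NormedAddCommGroup X] [InnerProductSpace 𝕜 X]
  [CompleteSpace X] [NormedSpace ℝ X] [IsScalarTower ℝ 𝕜 X]
  [NormedAddCommGroup U] [NormedSpace 𝕜 U] {Uc : InputSpace 𝕜 U}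

/-- If a trajectory satisfies `φ(t) = S(t) x + t B x + O(K t)`, then the Lie derivative of the
quadratic form of `P` differs from `-‖x‖²` by at most `2 ‖P‖ K ‖x‖`. -/
theorem lieDeriv_quadForm_le {sys : ControlSystem Uc X} {S : C0Semigroup 𝕜 X}
    (hS : S.IsAnalytic) {A : X →ₗ.[𝕜] X} (hA : S.IsGeneratedBy A) {B P : X →L[𝕜] X}
    (hP : IsSelfAdjoint P)
    (hLyap : ∀ x : (addBounded A B).domain,
      inner 𝕜 (addBounded A B x) (P x) + inner 𝕜 (P x) (addBounded A B x)
        = -((‖(x : X)‖ : 𝕜) ^ 2))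
    {x : X} {u : Uc.carrier} {K : ℝ}
    (hK : ∀ᶠ t in 𝓝[>] (0 : ℝ), ‖sys.φ t 0 x u - S t x - t • B x‖ ≤ t * K) :
    sys.lieDeriv (fun x => RCLike.re (inner 𝕜 (P x) x)) x u
      ≤ ((-‖x‖ ^ 2 + 2 * (‖P‖ * K * ‖x‖) : ℝ) : EReal) := by
  set V : X → ℝ := fun x => RCLike.re (inner 𝕜 (P x) x) with hV
  have hx : S 0 x = x := by rw [S.map_zero]; rfl
  -- A majorant of the difference quotient, from expanding `V` around `S(t)x` rather than `x`; its
  -- first two terms are those whose `B`-parts cancel in the limit.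
  set bd : ℝ → ℝ := fun t => t⁻¹ * (V (S t x) - V x) + 2 * RCLike.re (inner 𝕜 (P (B x)) (S t x))
    + 2 * (‖P‖ * K * ‖S t x‖) + t * (‖P‖ * (‖B x‖ + K) * (‖B x‖ + K)) with hbd
  have hlim : Tendsto bd (𝓝[>] 0) (𝓝 (-‖x‖ ^ 2 + 2 * (‖P‖ * K * ‖x‖))) := by
    have hc : Tendsto (fun t => S t x) (𝓝[>] 0) (𝓝 x) := by
      have h : ContinuousWithinAt (fun t => S t x) (Ioi 0) 0 :=
        (S.continuousOn x 0 self_mem_Ici).mono Ioi_subset_Ici_self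
      simpa only [ContinuousWithinAt, hx] using h
    have h1 : Tendsto (fun t : ℝ => t⁻¹ * (V (S t x) - V x)) (𝓝[>] 0)
        (𝓝 (-‖x‖ ^ 2 - 2 * RCLike.re (inner 𝕜 (P x) (B x)))) := by
      have h := (hasDerivWithinAt_quadForm_orbit hS hA hP hLyap x).mono Ioi_subset_Ici_self
      rw [hasDerivWithinAt_iff_tendsto_slope' self_notMem_Ioi] at h
      refine h.congr fun t => ?_
      rw [slope_def_field, sub_zero, hx, div_eq_inv_mul]
    have h2 : Tendsto (fun t : ℝ => RCLike.re (inner 𝕜 (P (B x)) (S t x))) (𝓝[>] 0)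
        (𝓝 (RCLike.re (inner 𝕜 (P (B x)) x))) :=
      (RCLike.continuous_re.tendsto _).comp (tendsto_const_nhds.inner hc)
    have h3 : Tendsto (fun t : ℝ => t) (𝓝[>] 0) (𝓝 0) := nhdsWithin_le_nhds
    have h := ((h1.add (h2.const_mul 2)).add ((hc.norm.const_mul (‖P‖ * K)).const_mul 2)).add
      (h3.mul_const (‖P‖ * (‖B x‖ + K) * (‖B x‖ + K)))
    convert h using 2
    rw [re_inner_apply_comm hP (B x) x]
    ring
  have hle : ∀ᶠ t in 𝓝[>] (0 : ℝ),
      ((t⁻¹ * (V (sys.φ t 0 x u) - V x) : ℝ) : EReal) ≤ ((bd t : ℝ) : EReal) := by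
    filter_upwards [hK, self_mem_nhdsWithin] with t ht ht0
    have ht0 : 0 < t := ht0
    rw [EReal.coe_le_coe_iff]
    obtain ⟨e, he⟩ : ∃ e : X, sys.φ t 0 x u = S t x + t • (B x + e) :=
      ⟨t⁻¹ • (sys.φ t 0 x u - S t x - t • B x), by
        rw [smul_add, smul_inv_smul₀ ht0.ne']; abel⟩
    have heK : ‖e‖ ≤ K := by
      rw [he, smul_add, add_sub_cancel_left, add_sub_cancel_left, norm_smul, Real.norm_eq_abs,
        abs_of_pos ht0] at ht
      exact le_of_mul_le_mul_left ht ht0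
    have hsm : t • (B x + e) = (t : 𝕜) • (B x + e) := (RCLike.real_smul_eq_coe_smul t _)
    have hexp : V (sys.φ t 0 x u) = V (S t x)
        + 2 * (t * RCLike.re (inner 𝕜 (P (B x + e)) (S t x)))
        + t * (t * RCLike.re (inner 𝕜 (P (B x + e)) (B x + e))) := by
      rw [he, hV]
      simp only
      rw [re_inner_apply_add_self hP, hsm]
      simp only [map_smul, inner_smul_left, inner_smul_right, RCLike.conj_ofReal,
        RCLike.re_ofReal_mul]
    have hq : t⁻¹ * (V (sys.φ t 0 x u) - V x) = t⁻¹ * (V (S t x) - V x)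
        + 2 * RCLike.re (inner 𝕜 (P (B x + e)) (S t x))
        + t * RCLike.re (inner 𝕜 (P (B x + e)) (B x + e)) := by
      rw [hexp]; field_simp; ring
    have hsum : ‖B x + e‖ ≤ ‖B x‖ + K := (norm_add_le _ _).trans (by linarith)
    have hK0 : 0 ≤ K := (norm_nonneg e).trans heK
    have h1 : RCLike.re (inner 𝕜 (P e) (S t x)) ≤ ‖P‖ * K * ‖S t x‖ :=
      (le_abs_self _).trans <| (abs_re_inner_apply_le P e _).trans (by gcongr)
    have h2 : RCLike.re (inner 𝕜 (P (B x + e)) (B x + e))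
        ≤ ‖P‖ * (‖B x‖ + K) * (‖B x‖ + K) :=
      (le_abs_self _).trans <| (abs_re_inner_apply_le P _ _).trans (by gcongr)
    have h3 : RCLike.re (inner 𝕜 (P (B x + e)) (S t x))
        = RCLike.re (inner 𝕜 (P (B x)) (S t x)) + RCLike.re (inner 𝕜 (P e) (S t x)) := by
      rw [map_add, inner_add_left, map_add]
    rw [hq, h3, hbd]
    have h4 := mul_le_mul_of_nonneg_left h2 ht0.le
    simp only
    linarith
  have hlim' : Tendsto (fun t => ((bd t : ℝ) : EReal)) (𝓝[>] 0)
      (𝓝 ((-‖x‖ ^ 2 + 2 * (‖P‖ * K * ‖x‖) : ℝ) : EReal)) :=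
    (continuous_coe_real_ereal.tendsto _).comp hlim
  exact (limsup_le_limsup hle).trans hlim'.limsup_eq.le

end LieDerivative

/-! ### Linear and quadratic comparison functions. -/

theorem classK_const_mul {k : ℝ} (hk : 0 < k) : ClassK fun r => k * r where
  continuousOn := by fun_prop
  strictMonoOn _ _ _ _ h := mul_lt_mul_of_pos_left h hk
  map_zero := mul_zero k

theorem classKInf_const_mul_sq {k : ℝ} (hk : 0 < k) : ClassKInf fun r => k * r ^ 2 where
  continuousOn := by fun_prop
  strictMonoOn _ ha _ _ h := mul_lt_mul_of_pos_left (pow_lt_pow_left₀ h ha two_ne_zero) hk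
  map_zero := by simp
  unbounded := by
    rintro ⟨b, hb⟩
    have h := hb ⟨|b| / k + 1, mem_Ici.2 (by positivity), rfl⟩
    have h1 : k * (|b| / k) = |b| := by field_simp
    have h2 : 0 ≤ |b| / k := by positivity
    nlinarith [le_abs_self b, mul_nonneg hk.le h2, mul_nonneg hk.le (mul_nonneg h2 h2)]

theorem posDefFun_const_mul_sq {k : ℝ} (hk : 0 < k) : PosDefFun fun r => k * r ^ 2 where
  continuousOn := by fun_prop
  map_zero := by simp
  pos _ hr := by positivity

end ISS

/-! ### Choice of constants and conclusion. -/

theorem mainTheorem4 {𝕜 X U : Type*} [RCLike 𝕜]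
    [NormedAddCommGroup X] [InnerProductSpace 𝕜 X] [CompleteSpace X]
    [NormedSpace ℝ X] [IsScalarTower ℝ 𝕜 X]
    [NormedAddCommGroup U] [NormedSpace 𝕜 U]
    (Uc : ISS.InputSpace 𝕜 U)
    -- `A` generates an analytic semigroup `S`
    (A : X →ₗ.[𝕜] X) (S : ISS.C0Semigroup 𝕜 X)
    (hA : S.IsGeneratedBy A) (hS : S.IsAnalytic)
    -- the nonlinearity `f`, defined on `Q`, and its decomposition
    (Q : Set (X × U)) (hQ : IsOpen Q) (h0Q : ((0 : X), (0 : U)) ∈ Q)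
    (f : X → U → X) (hf0 : f 0 0 = 0)
    (B : X →L[𝕜] X) (C : U →L[𝕜] X) (g : X → U → X)
    (hf : ∀ x u, (x, u) ∈ Q → f x u = B x + C u + g x u)
    (hg : ∀ w : ℝ, 0 < w → ∃ ρ : ℝ, 0 < ρ ∧ ∀ x u, ‖x‖ ≤ ρ → ‖u‖ ≤ ρ →
      ‖g x u‖ ≤ w * (‖x‖ + ‖u‖))
    -- the control system of the equation `ẋ = A x + f(x, u)`
    (sys : ISS.ControlSystem Uc X) (hsys : sys.IsMildFlow S Q f)
    -- the linear approximation `ẋ = R x + C u`, `R = A + B`, is ISS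
    (hISS : ∀ T : ISS.C0Semigroup 𝕜 X, T.IsGeneratedBy (ISS.addBounded A B) →
      (ISS.linearControlSystem Uc T C).IsISS)
    -- the coercive solution `P` of the Lyapunov equation
    (P : X →L[𝕜] X) (hP : ISS.IsCoerciveOperator P)
    (hLyap : ∀ x : (ISS.addBounded A B).domain,
      inner 𝕜 (ISS.addBounded A B x) (P x) + inner 𝕜 (P x) (ISS.addBounded A B x)
        = -((‖(x : X)‖ : 𝕜) ^ 2)) :
    sys.IsLISSLyapunovFunction Set.univ (fun x => RCLike.re (inner 𝕜 (P x) x)) := by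
  obtain ⟨ε, hε, hcoer⟩ := hP.coercive
  obtain ⟨c₀, hc₀⟩ := Uc.bounded
  obtain ⟨M₀, -, hM₀⟩ := S.exists_bound 1
  obtain ⟨M, hM1, hM⟩ : ∃ M : ℝ, 0 < M ∧ ∀ t ∈ Icc (0 : ℝ) 1, ‖S t‖ ≤ M :=
    ⟨|M₀| + 1, by positivity, fun t ht => by linarith [hM₀ t ht, le_abs_self M₀]⟩
  obtain ⟨c, hc, hcu⟩ : ∃ c : ℝ, 0 < c ∧ ∀ u : Uc.carrier,
      ∀ᵐ s ∂(volume.restrict (Ici (0 : ℝ))), ‖(u : ℝ → U) s‖ ≤ c * Uc.norm u := by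
    refine ⟨|c₀| + 1, by positivity, fun u => ?_⟩
    filter_upwards [hc₀ u] with s hs
    refine hs.trans (mul_le_mul_of_nonneg_right ?_ (apply_nonneg _ _))
    linarith [le_abs_self c₀]
  obtain ⟨p, hp1, hPp⟩ : ∃ p : ℝ, 1 ≤ p ∧ ‖P‖ ≤ p :=
    ⟨‖P‖ + 1, by linarith [norm_nonneg P], by linarith⟩
  have hp : 0 < p := by linarith
  -- The remainder then contributes only `(‖x‖ + δ)/16` to `p * K`, apart from its share in the
  -- input.
  obtain ⟨w, hw, hpMw⟩ : ∃ w : ℝ, 0 < w ∧ p * (M * w) = 1 / 16 :=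
    ⟨1 / (16 * (p * M)), by positivity, by field_simp⟩
  obtain ⟨ρ₁, hρ₁, hgw⟩ := hg w hw
  obtain ⟨ρ₂, hρ₂, hQρ⟩ := Metric.isOpen_iff.1 hQ _ h0Q
  obtain ⟨ρ, hρ, hρ1, hρ2⟩ : ∃ ρ : ℝ, 0 < ρ ∧ ρ ≤ ρ₁ ∧ ρ < ρ₂ :=
    ⟨min ρ₁ (ρ₂ / 2), by positivity, min_le_left _ _,
      (min_le_right _ _).trans_lt (half_lt_self hρ₂)⟩
  have hfw : ∀ y r, ‖y‖ ≤ ρ → ‖r‖ ≤ ρ →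
      (y, r) ∈ Q ∧ ‖f y r - (B y + C r)‖ ≤ w * (‖y‖ + ‖r‖) := by
    intro y r hy hr
    have hmem : (y, r) ∈ Q := hQρ (by
      rw [Metric.mem_ball, Prod.dist_eq, dist_zero_right, dist_zero_right]
      exact max_lt (hy.trans_lt hρ2) (hr.trans_lt hρ2))
    refine ⟨hmem, ?_⟩
    rw [hf y r hmem, add_sub_cancel_left]
    exact hgw y r (hy.trans hρ1) (hr.trans hρ1)
  have hcont : Continuous fun x : X => RCLike.re (inner 𝕜 (P x) x) :=
    RCLike.continuous_re.comp (P.continuous.inner continuous_id)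
  -- The slope of the gain `χ`: above it, the input contributes at most `‖x‖/16` to `p * K`.
  have hk : 0 < 16 * (p * (M * ((‖C‖ + w) * c))) := by positivity
  refine ⟨by simp, hcont.continuousOn,
    fun x _ => (by positivity : 0 ≤ ε * ‖x‖ ^ 2).trans (hcoer x),
    -- `ρ / 2` makes `‖x‖ < ρ` strict, leaving room for the trajectory to move; `ρ / c` makes the
    -- input essentially bounded by `ρ`.
    ρ / 2, ρ / c, by positivity, by positivity, by simp,
    _, _, _, _, ISS.classKInf_const_mul_sq hε, ISS.classKInf_const_mul_sq hp,
    ISS.classK_const_mul hk, ISS.posDefFun_const_mul_sq (one_half_pos (α := ℝ)),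
    fun x _ => ⟨hcoer x, ?_⟩, ?_⟩
  · refine (le_abs_self _).trans ((ISS.abs_re_inner_apply_le P x x).trans ?_)
    rw [mul_assoc, ← sq]
    gcongr
  · intro x hx u hu hχ
    have hv : c * Uc.norm u ≤ ρ := by
      rw [mul_comm]; exact (le_div_iff₀ hc).1 hu
    -- `δ` may depend on `x`, since only the limit `t → 0+` matters. At `x = 0` any positive value
    -- works because the error carries a factor `‖x‖`.
    obtain ⟨δ, hδ, hδx⟩ : ∃ δ : ℝ, 0 < δ ∧ 16 * (p * δ) * ‖x‖ ≤ ‖x‖ * ‖x‖ := by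
      rcases (norm_nonneg x).eq_or_lt with h | h
      · exact ⟨1, one_pos, by rw [← h]; simp⟩
      · exact ⟨‖x‖ / (16 * p), by positivity, le_of_eq (by field_simp)⟩
    have hdev := hsys.norm_sub_le hw.le hM hfw (by linarith) u (hcu u) hv hδ
    have hlie := ISS.lieDeriv_quadForm_le hS hA hP.isSelfAdjoint hLyap hdev
    refine hlie.trans (EReal.coe_le_coe_iff.2 ?_)
    set v := Uc.norm u with hvdef
    have hv0 : 0 ≤ v := apply_nonneg _ _
    set K := δ + M * ((‖C‖ + w) * (c * v) + w * (‖x‖ + δ)) with hK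
    have hK0 : 0 ≤ K := by positivity
    have hpK : p * K = p * δ + p * (M * ((‖C‖ + w) * c)) * v + 1 / 16 * (‖x‖ + δ) := by
      rw [hK, ← hpMw]; ring
    have hδp : δ ≤ p * δ := le_mul_of_one_le_left hδ.le hp1
    have hχ' : 16 * (p * (M * ((‖C‖ + w) * c)) * v) ≤ ‖x‖ := by linarith [hχ]
    have hbound : ‖P‖ * K ≤ 17 / 16 * (p * δ) + ‖x‖ / 8 := by
      linarith [mul_le_mul_of_nonneg_right hPp hK0]
    have := mul_le_mul_of_nonneg_right hbound (norm_nonneg x)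
    -- The error is at most `2 * (17/256 + 1/8) * ‖x‖²`, which is below `‖x‖²/2`.
    linarith [mul_self_nonneg ‖x‖, sq ‖x‖]
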